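/- Let $u$ be a linear functional on $\mathbb C[x]$ with moments $(u)_n=\langle u,x^n\rangle$ and $(u)_0=1$, and let $\{P_n\}_{n\ge0}$ be its monic orthogonal polynomial sequence: $P_n$ is monic of degree $n$ and $\langle u,P_nP_m\rangle=r_n\delta_{n,m}$ with $r_n\ne0$. Suppose that $u$ is a Laguerre–Hahn form: its formal Stieltjes function $S(z)=-\sum_{n\ge0}(u)_n z^{-n-1}$ satisfies $$\Phi S'=BS^2+CS+D$$ for some polynomials $\Phi,B,C,D\in\mathbb C[z]$. Then there are complex numbers $\beta_n$ $(n\ge0)$ and $\gamma_{n+1}\neq0$ $(n\ge0)$ with $P_0=1$, $P_1=x-\beta_0$, $P_{n+2}=(x-\beta_{n+1})P_{n+1}-\gamma_{n+1}P_n$. Put $B_0=B$, $C_0=C$, $D_0=D$, $D_{-1}=B$, $\gamma_0=1$, and define polynomials $C_n,D_n$ for $n\ge 0$ by $$C_{n+1}=-C_n+2(x-\beta_n)D_n,\qquad \gamma_{n+1}D_{n+1}=-\Phi+\gamma_nD_{n-1}-(x-\beta_n)C_n+(x-\beta_n)^2D_n .$$ Fix $n\ge0$ and write $\gamma=\gamma_{n+1}$,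 $D_+=D_{n+1}$, $\sigma=C_{n+1}+C_0$, $\delta=C_{n+1}-C_0$. Let $$\begin{aligned} &G_{0,1}=0,\quad G_{1,1}=B_0,\quad H_1=-\gamma D_+,\\ &G_{0,2}=-2\gamma B_0D_+,\quad G_{1,2}=\tfrac12\sigma B_0+\Phi B_0',\quad H_2=\gamma\{\tfrac12\sigma D_+-\Phi D_+'\},\\ &G_{0,3}=\gamma\{D_+\delta B_0-3\Phi(B_0D_+)'\},\\ &G_{1,3}=B_0\{\tfrac14\sigma^2-2\gamma D_nD_++\tfrac12\Phi\sigma'\}+\Phi B_0'\{\sigma+\Phi'\}+\Phi^2B_0'',\\ &H_3=\gamma\{2B_0D_0+\tfrac12\sigma'\Phi-\tfrac14\sigma^2\}D_++\gamma\Phi(\sigma-\Phi')D_+'-\gamma\Phi^2D_+'',\\ &G_{0,4}=-\tfrac12\delta G_{0,3}-\gamma D_+G_{1,3}+B_0H_3+\Phi G_{0,3}',\\ &G_{1,4}=D_nG_{0,3}+\tfrac12\sigma G_{1,3}+\Phi G_{1,3}',\quad H_4=-D_0G_{0,3}-\tfrac12\sigma H_3+\Phi H_3',\\ &M_{0,1}=-\tfrac12\delta,\quad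 M_{1,2}=\Phi(\Phi'+M_{0,1}),\quad M_{0,2}=\Phi M_{0,1}'+B_0D_0+\gamma D_nD_+,\\ &M_{2,3}=\Phi(M_{1,2}+2\Phi\Phi'),\quad M_{1,3}=\Phi(M_{0,2}+M_{1,2}'),\quad M_{0,3}=\Phi M_{0,2}'+D_0G_{1,2}-D_nH_2,\\ &M_{3,4}=\Phi(M_{2,3}+3\Phi^2\Phi'),\quad M_{2,4}=\Phi(M_{2,3}'+M_{1,3}),\quad M_{1,4}=\Phi(M_{1,3}'+M_{0,3}),\\ &M_{0,4}=\Phi M_{0,3}'+D_0G_{1,3}-D_nH_3 . \end{aligned}$$ For $1\le k\le4$ let $\Delta_k$ be the determinant of the $3\times3$ matrix obtained from the $4\times3$ matrix with rows $(G_{0,j},G_{1,j},H_j)$, $j=1,\dots,4$, by deleting the $k$-th row, and let $$\begin{aligned} \mathcal A&=\Phi^4\Delta_4,\\ \mathcal B&=M_{3,4}\Delta_4-\Phi^3\Delta_3,\\ \mathcal C&=M_{2,4}\Delta_4-M_{2,3}\Delta_3+\Phi^2\Delta_2,\\ \mathcal D&=M_{1,4}\Delta_4-M_{1,3}\Delta_3+M_{1,2}\Delta_2-\Phi\Delta_1,\\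 \mathcal E&=M_{0,4}\Delta_4-M_{0,3}\Delta_3+M_{0,2}\Delta_2-M_{0,1}\Delta_1 . \end{aligned}$$ Then, for every $n\ge0$, $$\mathcal A P_{n+1}^{(4)}+\mathcal B P_{n+1}^{(3)}+\mathcal C P_{n+1}''+\mathcal D P_{n+1}'+\mathcal E P_{n+1}=0 .$$ Moreover, the left-hand side is the determinant of the $4\times4$ matrix with rows $(G_{0,j},G_{1,j},H_j,F_j)$, $j=1,\dots,4$, where $F_j=\Phi^jP_{n+1}^{(j)}+\sum_{i=0}^{j-1}M_{i,j}P_{n+1}^{(i)}$. -/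

import Mathlib

open Polynomial

noncomputable section

namespace LaguerreHahn

/-- A form is a linear functional on complex polynomials. -/
abbrev Form : Type := Module.Dual ℂ ℂ[X]

/-- The moments `(u)_n = ⟨u, x ^ n⟩` of a form. -/
def moment (u : Form) (n : ℕ) : ℂ := u (X ^ n)

/-- `P` is the monic orthogonal polynomial sequence (MOPS) of the form `u`:
`P n` is monic of degree `n`, and `⟨u, P n * P m⟩ = r n * δ_{n,m}` with all `r n ≠ 0`. -/
def IsMOPS (u : Form) (P : ℕ → ℂ[X]) : Prop :=
  (∀ n, (P n).Monic ∧ (P n).natDegree = n) ∧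
  ∃ r : ℕ → ℂ, (∀ n, r n ≠ 0) ∧ ∀ n m, u (P n * P m) = if n = m then r n else 0

/-- `β` and `γ` are the coefficients of the three-term recurrence of `P`.
The value `γ 0` plays no role. -/
def IsRecurrence (P : ℕ → ℂ[X]) (β γ : ℕ → ℂ) : Prop :=
  (∀ n, γ (n + 1) ≠ 0) ∧
  P 0 = 1 ∧ P 1 = X - C (β 0) ∧
  ∀ n, P (n + 2) = (X - C (β (n + 1))) * P (n + 1) - C (γ (n + 1)) * P n

/-! ### Formal series in `1/z`

A formal Laurent series in `1/z` is an element of `LaurentSeries ℂ` whose variable `t` stands for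
`1/z`: the coefficient at `k : ℤ` is the coefficient of `z ^ (-k)`. -/

/-- The formal Stieltjes function `S(u)(z) = - ∑ n, (u)_n / z ^ (n + 1)`. -/
def stieltjes (u : Form) : LaurentSeries ℂ :=
  -(HahnSeries.single (1 : ℤ) (1 : ℂ) * HahnSeries.ofPowerSeries ℤ ℂ (PowerSeries.mk (moment u)))

/-- The derivation `d/dz = - t ^ 2 d/dt`, where `t = 1/z`. -/
def zDeriv (f : LaurentSeries ℂ) : LaurentSeries ℂ :=
  -(HahnSeries.single (2 : ℤ) (1 : ℂ) * LaurentSeries.derivative ℂ f)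

/-- A polynomial in `z = t⁻¹`, as a Laurent series in `t`. -/
def polyInZ (p : ℂ[X]) : LaurentSeries ℂ :=
  eval₂ (HahnSeries.C : ℂ →+* LaurentSeries ℂ) (HahnSeries.single (-1 : ℤ) (1 : ℂ)) p

/-- The Riccati equation `Φ S' = B S² + C S + D` for the formal Stieltjes function of `u`. -/
def SatisfiesRiccati (u : Form) (Φ B C D : ℂ[X]) : Prop :=
  polyInZ Φ * zDeriv (stieltjes u) =
    polyInZ B * stieltjes u ^ 2 + polyInZ C * stieltjes u + polyInZ D

/-- The data on which the coefficients of the differential equation depend: the polynomials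
`Φ`, `B = B_0`, `C = C_0`, `D = D_0` of the Riccati equation and the recurrence coefficients. -/
structure Data where
  Φ : ℂ[X]
  B₀ : ℂ[X]
  C₀ : ℂ[X]
  D₀ : ℂ[X]
  β : ℕ → ℂ
  γ : ℕ → ℂ

namespace Data

variable (L : Data)

/-- The triple `(C_n, D_n, γ_n D_{n-1})`, where at `n = 0` the last entry is `B`
(that is, `γ_0 = 1` and `D_{-1} = B`). -/
def seqCD : ℕ → ℂ[X] × ℂ[X] × ℂ[X]
  | 0 => (L.C₀, L.D₀, L.B₀)
  | n + 1 =>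
    (-(seqCD n).1 + 2 * (X - Polynomial.C (L.β n)) * (seqCD n).2.1,
      Polynomial.C (L.γ (n + 1))⁻¹ *
        (-L.Φ + (seqCD n).2.2 - (X - Polynomial.C (L.β n)) * (seqCD n).1
          + (X - Polynomial.C (L.β n)) ^ 2 * (seqCD n).2.1),
      Polynomial.C (L.γ (n + 1)) * (seqCD n).2.1)

/-- The polynomials `C_n` of the structure relation. -/
def Cn (n : ℕ) : ℂ[X] := (L.seqCD n).1

/-- The polynomials `D_n` of the structure relation. -/
def Dn (n : ℕ) : ℂ[X] := (L.seqCD n).2.1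

theorem Cn_zero : L.Cn 0 = L.C₀ := rfl

theorem Dn_zero : L.Dn 0 = L.D₀ := rfl

theorem Cn_succ (n : ℕ) :
    L.Cn (n + 1) = -L.Cn n + 2 * (X - Polynomial.C (L.β n)) * L.Dn n := rfl

theorem Dn_one (h : L.γ 1 ≠ 0) :
    Polynomial.C (L.γ 1) * L.Dn 1 =
      -L.Φ + L.B₀ - (X - Polynomial.C (L.β 0)) * L.Cn 0
        + (X - Polynomial.C (L.β 0)) ^ 2 * L.Dn 0 := by
  have e : Polynomial.C (L.γ 1) * Polynomial.C (L.γ 1)⁻¹ = 1 := by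
    rw [← Polynomial.C_mul, mul_inv_cancel₀ h, Polynomial.C_1]
  simp only [Dn, Cn, seqCD, zero_add]
  rw [← mul_assoc, e, one_mul]

theorem Dn_succ_succ (n : ℕ) (h : L.γ (n + 2) ≠ 0) :
    Polynomial.C (L.γ (n + 2)) * L.Dn (n + 2) =
      -L.Φ + Polynomial.C (L.γ (n + 1)) * L.Dn n
        - (X - Polynomial.C (L.β (n + 1))) * L.Cn (n + 1)
        + (X - Polynomial.C (L.β (n + 1))) ^ 2 * L.Dn (n + 1) := by
  have e : Polynomial.C (L.γ (n + 2)) * Polynomial.C (L.γ (n + 2))⁻¹ = 1 := by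
    rw [← Polynomial.C_mul, mul_inv_cancel₀ h, Polynomial.C_1]
  simp only [Dn, Cn, seqCD]
  rw [← mul_assoc, e, one_mul]

/-- The constant polynomial `γ_{n+1}`. -/
def g (n : ℕ) : ℂ[X] := Polynomial.C (L.γ (n + 1))

/-- `(C_{n+1} + C_0) / 2`. -/
def halfSum (n : ℕ) : ℂ[X] := Polynomial.C (1 / 2) * (L.Cn (n + 1) + L.C₀)

/-- `(C_{n+1} - C_0) / 2`. -/
def halfDiff (n : ℕ) : ℂ[X] := Polynomial.C (1 / 2) * (L.Cn (n + 1) - L.C₀)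

/-! ### The coefficients `G_{0,k}`, `G_{1,k}`, `H_k`, `M_{j,k}` -/

def G01 (_ : Data) (_ : ℕ) : ℂ[X] := 0

def G11 (_ : ℕ) : ℂ[X] := L.B₀

def H1 (n : ℕ) : ℂ[X] := -(L.g n * L.Dn (n + 1))

def G02 (n : ℕ) : ℂ[X] := -(2 * L.g n * L.B₀ * L.Dn (n + 1))

def G12 (n : ℕ) : ℂ[X] := L.halfSum n * L.B₀ + L.Φ * derivative L.B₀

def H2 (n : ℕ) : ℂ[X] :=
  L.g n * (L.halfSum n * L.Dn (n + 1) - L.Φ * derivative (L.Dn (n + 1)))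

def G03 (n : ℕ) : ℂ[X] :=
  L.g n * (L.Dn (n + 1) * (L.Cn (n + 1) - L.C₀) * L.B₀
    - 3 * L.Φ * derivative (L.B₀ * L.Dn (n + 1)))

def G13 (n : ℕ) : ℂ[X] :=
  L.B₀ * (Polynomial.C (1 / 4) * (L.Cn (n + 1) + L.C₀) ^ 2
      - 2 * L.g n * L.Dn n * L.Dn (n + 1)
      + Polynomial.C (1 / 2) * L.Φ * derivative (L.Cn (n + 1) + L.C₀))
    + L.Φ * derivative L.B₀ * (L.Cn (n + 1) + L.C₀ + derivative L.Φ)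
    + L.Φ ^ 2 * derivative (derivative L.B₀)

def H3 (n : ℕ) : ℂ[X] :=
  L.g n * (2 * L.B₀ * L.D₀
      + Polynomial.C (1 / 2) * derivative (L.Cn (n + 1) + L.C₀) * L.Φ
      - Polynomial.C (1 / 4) * (L.Cn (n + 1) + L.C₀) ^ 2) * L.Dn (n + 1)
    + L.g n * L.Φ * (L.Cn (n + 1) + L.C₀ - derivative L.Φ) * derivative (L.Dn (n + 1))
    - L.g n * L.Φ ^ 2 * derivative (derivative (L.Dn (n + 1)))

def G04 (n : ℕ) : ℂ[X] :=
  -(L.halfDiff n * L.G03 n) - L.g n * L.Dn (n + 1) * L.G13 n + L.B₀ * L.H3 n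
    + L.Φ * derivative (L.G03 n)

def G14 (n : ℕ) : ℂ[X] :=
  L.Dn n * L.G03 n + L.halfSum n * L.G13 n + L.Φ * derivative (L.G13 n)

def H4 (n : ℕ) : ℂ[X] :=
  -(L.D₀ * L.G03 n) - L.halfSum n * L.H3 n + L.Φ * derivative (L.H3 n)

def M01 (n : ℕ) : ℂ[X] := -L.halfDiff n

def M12 (n : ℕ) : ℂ[X] := L.Φ * (derivative L.Φ + L.M01 n)

def M02 (n : ℕ) : ℂ[X] :=
  L.Φ * derivative (L.M01 n) + L.B₀ * L.D₀ + L.g n * L.Dn n * L.Dn (n + 1)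

def M23 (n : ℕ) : ℂ[X] := L.Φ * (L.M12 n + 2 * L.Φ * derivative L.Φ)

def M13 (n : ℕ) : ℂ[X] := L.Φ * (L.M02 n + derivative (L.M12 n))

def M03 (n : ℕ) : ℂ[X] :=
  L.Φ * derivative (L.M02 n) + L.D₀ * L.G12 n - L.Dn n * L.H2 n

def M34 (n : ℕ) : ℂ[X] := L.Φ * (L.M23 n + 3 * L.Φ ^ 2 * derivative L.Φ)

def M24 (n : ℕ) : ℂ[X] := L.Φ * (derivative (L.M23 n) + L.M13 n)

def M14 (n : ℕ) : ℂ[X] := L.Φ * (derivative (L.M13 n) + L.M03 n)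

def M04 (n : ℕ) : ℂ[X] :=
  L.Φ * derivative (L.M03 n) + L.D₀ * L.G13 n - L.Dn n * L.H3 n

/-! ### The right-hand sides `F_k`, as expressions in a polynomial `y` (to be `P_{n+1}`) -/

def F1 (n : ℕ) (y : ℂ[X]) : ℂ[X] := L.Φ * derivative y + L.M01 n * y

def F2 (n : ℕ) (y : ℂ[X]) : ℂ[X] :=
  L.Φ ^ 2 * derivative^[2] y + L.M12 n * derivative y + L.M02 n * y

def F3 (n : ℕ) (y : ℂ[X]) : ℂ[X] :=
  L.Φ ^ 3 * derivative^[3] y + L.M23 n * derivative^[2] y + L.M13 n * derivative y + L.M03 n * y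

def F4 (n : ℕ) (y : ℂ[X]) : ℂ[X] :=
  L.Φ ^ 4 * derivative^[4] y + L.M34 n * derivative^[3] y + L.M24 n * derivative^[2] y
    + L.M14 n * derivative y + L.M04 n * y

/-! ### The minors `Δ_k` and the coefficients of the differential equation -/

def Δ4 (n : ℕ) : ℂ[X] :=
  L.G01 n * (L.G12 n * L.H3 n - L.G13 n * L.H2 n)
    - L.G11 n * (L.G02 n * L.H3 n - L.G03 n * L.H2 n)
    + L.H1 n * (L.G02 n * L.G13 n - L.G03 n * L.G12 n)

def Δ3 (n : ℕ) : ℂ[X] :=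
  L.G01 n * (L.G12 n * L.H4 n - L.G14 n * L.H2 n)
    - L.G11 n * (L.G02 n * L.H4 n - L.G04 n * L.H2 n)
    + L.H1 n * (L.G02 n * L.G14 n - L.G04 n * L.G12 n)

def Δ2 (n : ℕ) : ℂ[X] :=
  L.G01 n * (L.G13 n * L.H4 n - L.G14 n * L.H3 n)
    - L.G11 n * (L.G03 n * L.H4 n - L.G04 n * L.H3 n)
    + L.H1 n * (L.G03 n * L.G14 n - L.G04 n * L.G13 n)

def Δ1 (n : ℕ) : ℂ[X] :=
  L.G02 n * (L.G13 n * L.H4 n - L.G14 n * L.H3 n)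
    - L.G12 n * (L.G03 n * L.H4 n - L.G04 n * L.H3 n)
    + L.H2 n * (L.G03 n * L.G14 n - L.G04 n * L.G13 n)

def coeffA (n : ℕ) : ℂ[X] := L.Φ ^ 4 * L.Δ4 n

def coeffB (n : ℕ) : ℂ[X] := L.M34 n * L.Δ4 n - L.Φ ^ 3 * L.Δ3 n

def coeffC (n : ℕ) : ℂ[X] := L.M24 n * L.Δ4 n - L.M23 n * L.Δ3 n + L.Φ ^ 2 * L.Δ2 n

def coeffD (n : ℕ) : ℂ[X] :=
  L.M14 n * L.Δ4 n - L.M13 n * L.Δ3 n + L.M12 n * L.Δ2 n - L.Φ * L.Δ1 n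

def coeffE (n : ℕ) : ℂ[X] :=
  L.M04 n * L.Δ4 n - L.M03 n * L.Δ3 n + L.M02 n * L.Δ2 n - L.M01 n * L.Δ1 n

/-- The `4 × 4` matrix of the system, with the right-hand sides in the last column. -/
def systemMatrix (n : ℕ) (y : ℂ[X]) : Matrix (Fin 4) (Fin 4) ℂ[X] :=
  !![L.G01 n, L.G11 n, L.H1 n, L.F1 n y;
     L.G02 n, L.G12 n, L.H2 n, L.F2 n y;
     L.G03 n, L.G13 n, L.H3 n, L.F3 n y;
     L.G04 n, L.G14 n, L.H4 n, L.F4 n y]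

end Data

end LaguerreHahn

end

open Polynomial

namespace LaguerreHahn

/-! Orthogonality yields the three-term recurrence. Let `y`, `p` be `P (n+1)`, `P n` and `w`, `q`
the associated polynomials. The recurrences for `P`, `Cn` and `Dn` alone force a closed first-order
linear system for `(y, p, w, q)` (`structureRelations`). Its first line puts `F1` in the span of
`q`, `w`, `p`. Applying `Φ d/dx` repeatedly, and moving the resulting multiple of `y` to the left,
gives `F_j = G_{0,j} q + G_{1,j} w + H_j p` for j = 1, …, 4. So the last column of `systemMatrix`
depends on the other three and its determinant vanishes; expanding along that column and sorting by
derivatives of `y` gives the equation. -/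

theorem degree_sub_leadingTerm_lt {R : ℕ → ℂ[X]}
    (hR : ∀ n, (R n).Monic ∧ (R n).natDegree = n) {q : ℂ[X]} {d : ℕ}
    (hq : q.degree < ((d + 1 : ℕ) : WithBot ℕ)) :
    (q - C (q.coeff d) * R d).degree < (d : WithBot ℕ) := by
  rw [degree_lt_iff_coeff_zero] at hq ⊢
  intro k hk
  rcases hk.eq_or_lt with rfl | hlt
  · have h : (R d).coeff d = 1 := by
      have := (hR d).1.coeff_natDegree
      rwa [(hR d).2] at this
    simp [h]
  · have h : (R d).coeff k = 0 := coeff_eq_zero_of_natDegree_lt (by rw [(hR d).2]; exact hlt)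
    simp [h, hq k hlt]

/-! ### Orthogonality and the three-term recurrence -/

namespace IsMOPS

variable {u : Form} {P : ℕ → ℂ[X]}

theorem apply_mul_eq_zero (hP : IsMOPS u P) {m : ℕ} (d : ℕ) (hd : d ≤ m) {q : ℂ[X]}
    (hq : q.degree < (d : WithBot ℕ)) : u (P m * q) = 0 := by
  obtain ⟨hmon, r, -, horth⟩ := hP
  induction d generalizing q with
  | zero =>
    have : q = 0 := by simpa [Nat.WithBot.lt_zero_iff] using hq
    simp [this]
  | succ d ih =>
    have h := ih (by omega) (degree_sub_leadingTerm_lt hmon hq)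
    have e : P m * q = P m * (q - C (q.coeff d) * P d) + q.coeff d • (P m * P d) := by
      rw [smul_eq_C_mul]; ring
    rw [e, map_add, map_smul, h, horth, if_neg (by omega), smul_zero, add_zero]

/-- Pairing with `P d` isolates the top coefficient times `r d ≠ 0`, so the degree bound drops one
step at a time. -/
theorem eq_zero_of_apply_mul_eq_zero (hP : IsMOPS u P) (m : ℕ) {q : ℂ[X]}
    (hq : q.degree < (m : WithBot ℕ)) (h : ∀ k < m, u (P k * q) = 0) : q = 0 := by
  induction m with
  | zero => simpa [Nat.WithBot.lt_zero_iff] using hq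
  | succ d ih =>
    obtain ⟨r, hr, horth⟩ := hP.2
    have hlow := degree_sub_leadingTerm_lt hP.1 hq
    have e : P d * q = P d * (q - C (q.coeff d) * P d) + q.coeff d • (P d * P d) := by
      rw [smul_eq_C_mul]; ring
    have hz := h d (by omega)
    rw [e, map_add, map_smul, hP.apply_mul_eq_zero d le_rfl hlow, horth, if_pos rfl, zero_add,
      smul_eq_mul] at hz
    have hc : q.coeff d = 0 := (mul_eq_zero.1 hz).resolve_right (hr d)
    rw [hc, C_0, zero_mul, sub_zero] at hlow
    exact ih hlow fun k hk => h k (by omega)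

theorem coeff_self (hP : IsMOPS u P) (n : ℕ) : (P n).coeff n = 1 := by
  have := (hP.1 n).1.coeff_natDegree
  rwa [(hP.1 n).2] at this

theorem coeff_of_lt (hP : IsMOPS u P) {n k : ℕ} (h : n < k) : (P n).coeff k = 0 :=
  coeff_eq_zero_of_natDegree_lt (by rw [(hP.1 n).2]; exact h)

theorem exists_three_term (hP : IsMOPS u P) (n : ℕ) :
    ∃ b g : ℂ, g ≠ 0 ∧ P (n + 2) = (X - C b) * P (n + 1) - C g * P n := by
  obtain ⟨r, hr, horth⟩ := hP.2
  -- These values are forced by pairing the recurrence with `P (n+1)` and `P n`.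
  set b := u (P (n + 1) * (X * P (n + 1))) / r (n + 1) with hb
  set g := r (n + 1) / r n with hg
  refine ⟨b, g, div_ne_zero (hr _) (hr _), ?_⟩
  rw [← sub_eq_zero]
  refine hP.eq_zero_of_apply_mul_eq_zero (n + 2) ?_ ?_
  · rw [degree_lt_iff_coeff_zero]
    intro k hk
    obtain ⟨k, rfl⟩ : ∃ j, k = j + 1 := ⟨k - 1, by omega⟩
    rw [sub_mul]
    simp only [coeff_sub, coeff_C_mul, coeff_X_mul]
    rw [hP.coeff_of_lt (show n + 1 < k + 1 by omega), hP.coeff_of_lt (show n < k + 1 by omega)]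
    rcases (show n + 1 ≤ k by omega).eq_or_lt with rfl | hlt
    · rw [hP.coeff_self, hP.coeff_self]; ring
    · rw [hP.coeff_of_lt hlt, hP.coeff_of_lt (show n + 2 < k + 1 by omega)]; ring
  · intro k hk
    have e : P k * (P (n + 2) - ((X - C b) * P (n + 1) - C g * P n)) =
        P k * P (n + 2) - P (n + 1) * (X * P k) + b • (P k * P (n + 1)) + g • (P k * P n) := by
      rw [smul_eq_C_mul, smul_eq_C_mul]; ring
    rw [e, map_add, map_add, map_sub, map_smul, map_smul, horth, horth, horth,
      if_neg (by omega : k ≠ n + 2)]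
    rcases (show k ≤ n + 1 by omega).eq_or_lt with rfl | hlt
    · rw [if_pos rfl, if_neg (by omega), hb, smul_eq_mul, div_mul_cancel₀ _ (hr _)]
      simp
    · rw [if_neg (by omega)]
      rcases (show k ≤ n by omega).eq_or_lt with rfl | hlt'
      -- Here k = n: `X * P n` and `P (n+1)` share their leading term, so pairing either with `P
      -- (n+1)` gives `r (n+1)`.
      · have hdeg : (X * P k - P (k + 1)).degree < ((k + 1 : ℕ) : WithBot ℕ) := by
          rw [degree_lt_iff_coeff_zero]
          intro j hj
          obtain ⟨j, rfl⟩ : ∃ i, j = i + 1 := ⟨j - 1, by omega⟩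
          rw [coeff_sub, coeff_X_mul]
          rcases (show k ≤ j by omega).eq_or_lt with rfl | hlt
          · rw [hP.coeff_self, hP.coeff_self, sub_self]
          · rw [hP.coeff_of_lt hlt, hP.coeff_of_lt (show k + 1 < j + 1 by omega), sub_self]
        have h := hP.apply_mul_eq_zero (k + 1) le_rfl hdeg
        rw [mul_sub, map_sub, horth, if_pos rfl, sub_eq_zero] at h
        rw [h, if_pos rfl, hg, smul_eq_mul, smul_eq_mul, div_mul_cancel₀ _ (hr _)]
        simp
      · have hdeg : (X * P k).degree < ((n + 1 : ℕ) : WithBot ℕ) := by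
          rw [degree_lt_iff_coeff_zero]
          intro j hj
          obtain ⟨j, rfl⟩ : ∃ i, j = i + 1 := ⟨j - 1, by omega⟩
          rw [coeff_X_mul, hP.coeff_of_lt (show k < j by omega)]
        rw [hP.apply_mul_eq_zero (n + 1) le_rfl hdeg, if_neg (by omega)]
        simp

theorem exists_isRecurrence (hP : IsMOPS u P) : ∃ β γ : ℕ → ℂ, IsRecurrence P β γ := by
  choose b g hg hrec using hP.exists_three_term
  -- Indices shift by one: `β 0` is read off `P 1`, and `γ 0` takes the irrelevant value `g 0`.
  refine ⟨fun n => if n = 0 then -(P 1).coeff 0 else b (n - 1), fun n => g (n - 1),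
    fun n => by simpa using hg n, ?_, ?_, fun n => by simpa using hrec n⟩
  · exact (hP.1 0).1.natDegree_eq_zero.1 (hP.1 0).2
  · ext k
    rcases k with _ | _ | k
    · simp
    · simpa [coeff_C] using hP.coeff_self 1
    · rw [hP.coeff_of_lt (by omega)]
      simp [coeff_X]

end IsMOPS

/-! ### The first-order differential system -/

namespace Data

variable (L : Data)

/-- The associated polynomials of the first kind, shifted by one: `assoc n` has degree `n - 1`. -/
noncomputable def assoc : ℕ → ℂ[X]
  | 0 => 0
  | 1 => 1
  | n + 2 => (X - Polynomial.C (L.β (n + 1))) * assoc (n + 1) - Polynomial.C (L.γ (n + 1)) * assoc n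

theorem two_mul_halfSum (n : ℕ) : 2 * L.halfSum n = L.Cn (n + 1) + L.C₀ := by
  have h : (2 : ℂ[X]) * Polynomial.C (1 / 2) = 1 := by
    rw [← C_ofNat, ← C_mul]; norm_num
  rw [halfSum, ← mul_assoc, h, one_mul]

theorem two_mul_halfDiff (n : ℕ) : 2 * L.halfDiff n = L.Cn (n + 1) - L.C₀ := by
  have h : (2 : ℂ[X]) * Polynomial.C (1 / 2) = 1 := by
    rw [← C_ofNat, ← C_mul]; norm_num
  rw [halfDiff, ← mul_assoc, h, one_mul]

theorem halfSum_zero : L.halfSum 0 = (X - Polynomial.C (L.β 0)) * L.D₀ := by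
  apply mul_left_cancel₀ (two_ne_zero' ℂ[X])
  rw [two_mul_halfSum, Cn_succ, Cn_zero, Dn_zero]; ring

theorem halfDiff_zero : L.halfDiff 0 = (X - Polynomial.C (L.β 0)) * L.D₀ - L.C₀ := by
  apply mul_left_cancel₀ (two_ne_zero' ℂ[X])
  rw [two_mul_halfDiff, Cn_succ, Cn_zero, Dn_zero]; ring

theorem halfSum_succ (n : ℕ) : L.halfSum (n + 1) =
    (X - Polynomial.C (L.β (n + 1))) * L.Dn (n + 1) - L.halfDiff n := by
  apply mul_left_cancel₀ (two_ne_zero' ℂ[X])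
  rw [mul_sub, two_mul_halfSum, two_mul_halfDiff, Cn_succ]; ring

theorem halfDiff_succ (n : ℕ) : L.halfDiff (n + 1) =
    (X - Polynomial.C (L.β (n + 1))) * L.Dn (n + 1) - L.halfSum n := by
  apply mul_left_cancel₀ (two_ne_zero' ℂ[X])
  rw [mul_sub, two_mul_halfDiff, two_mul_halfSum, Cn_succ]; ring

/-- The differential system satisfied by `P (n + 1)`, `P n` and the associated polynomials. -/
structure StructureRelations (n : ℕ) (y p w q : ℂ[X]) : Prop where
  y_eq : L.Φ * derivative y = L.halfDiff n * y - L.g n * L.Dn (n + 1) * p + L.B₀ * w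
  p_eq : L.Φ * derivative p = L.Dn n * y - L.halfSum n * p + L.B₀ * q
  w_eq : L.Φ * derivative w = L.halfSum n * w - L.g n * L.Dn (n + 1) * q - L.D₀ * y
  q_eq : L.Φ * derivative q = L.Dn n * w - L.halfDiff n * q - L.D₀ * p

theorem structureRelations {P : ℕ → ℂ[X]} (hP : IsRecurrence P L.β L.γ) (n : ℕ) :
    L.StructureRelations n (P (n + 1)) (P n) (L.assoc (n + 1)) (L.assoc n) := by
  obtain ⟨hγ, h0, h1, hrec⟩ := hP
  induction n with
  | zero =>
    have hD := L.Dn_one (hγ 0)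
    rw [Cn_zero, Dn_zero] at hD
    constructor <;>
      simp only [zero_add, h0, h1, assoc, halfSum_zero, halfDiff_zero, Dn_zero, g, derivative_sub,
        derivative_X, derivative_C, derivative_one, derivative_zero]
    -- Only the `y` line needs the recurrence for `D_1`, where `B₀` stands for `γ_0 D_{-1}`.
    · linear_combination hD
    all_goals ring
  | succ n ih =>
    obtain ⟨hy, hp, hw, hq⟩ := ih
    have hD := L.Dn_succ_succ n (hγ (n + 1))
    have hs := L.two_mul_halfSum n
    have hd := L.two_mul_halfDiff n
    have hC : L.Cn (n + 1) = L.halfSum n + L.halfDiff n := by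
      apply mul_left_cancel₀ (two_ne_zero' ℂ[X])
      linear_combination -hs - hd
    rw [hC] at hD
    simp only [g] at hy hp hw hq
    constructor <;>
      simp only [hrec, assoc, halfSum_succ, halfDiff_succ, g, derivative_sub, derivative_mul,
        derivative_X, derivative_C]
    · linear_combination (X - Polynomial.C (L.β (n + 1))) * hy - Polynomial.C (L.γ (n + 1)) * hp
        + P (n + 1) * hD
    -- After the recurrence is substituted, the `p` line at n + 1 is the `y` line at n; likewise `q`
    -- from `w` below.
    · linear_combination hy
    · linear_combination (X - Polynomial.C (L.β (n + 1))) * hw - Polynomial.C (L.γ (n + 1)) * hq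
        + L.assoc (n + 1) * hD
    · linear_combination hw

namespace StructureRelations

variable {L} {n : ℕ} {y p w q : ℂ[X]}

/-- One elimination step: the coefficients of `q`, `w`, `p` are the next `G₀`, `G₁`, `H`, while that
of `y`, moved to the left, enters the next `M_{0,j}`. -/
theorem mul_derivative_comb (h : L.StructureRelations n y p w q) (G₀ G₁ H : ℂ[X]) :
    L.Φ * derivative (G₀ * q + G₁ * w + H * p) =
      (-(L.halfDiff n * G₀) - L.g n * L.Dn (n + 1) * G₁ + L.B₀ * H + L.Φ * derivative G₀) * q
      + (L.Dn n * G₀ + L.halfSum n * G₁ + L.Φ * derivative G₁) * w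
      + (-(L.D₀ * G₀) - L.halfSum n * H + L.Φ * derivative H) * p
      + (L.Dn n * H - L.D₀ * G₁) * y := by
  simp only [derivative_add, derivative_mul]
  linear_combination G₀ * h.q_eq + G₁ * h.w_eq + H * h.p_eq

theorem F1_eq (h : L.StructureRelations n y p w q) :
    L.F1 n y = L.G01 n * q + L.G11 n * w + L.H1 n * p := by
  simp only [F1, M01, G01, G11, H1]
  linear_combination h.y_eq

end StructureRelations

/-! ### Closed forms of the coefficients agree with the elimination step -/

theorem derivative_g (n : ℕ) : derivative (L.g n) = 0 := derivative_C

theorem G02_eq (n : ℕ) : L.G02 n = -(L.halfDiff n * L.G01 n) - L.g n * L.Dn (n + 1) * L.G11 n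
    + L.B₀ * L.H1 n + L.Φ * derivative (L.G01 n) := by
  simp only [G02, G01, G11, H1, derivative_zero]; ring

theorem G12_eq (n : ℕ) : L.G12 n =
    L.Dn n * L.G01 n + L.halfSum n * L.G11 n + L.Φ * derivative (L.G11 n) := by
  simp only [G12, G01, G11]; ring

theorem H2_eq (n : ℕ) : L.H2 n =
    -(L.D₀ * L.G01 n) - L.halfSum n * L.H1 n + L.Φ * derivative (L.H1 n) := by
  simp only [H2, G01, H1, derivative_neg, derivative_mul, derivative_g]; ring

theorem G03_eq (n : ℕ) : L.G03 n = -(L.halfDiff n * L.G02 n) - L.g n * L.Dn (n + 1) * L.G12 n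
    + L.B₀ * L.H2 n + L.Φ * derivative (L.G02 n) := by
  simp only [G03, ← two_mul_halfDiff, G02, G12, H2, derivative_neg, derivative_mul, derivative_g,
    derivative_ofNat]
  ring

theorem C_quarter_mul_sq (n : ℕ) :
    Polynomial.C (1 / 4) * (L.Cn (n + 1) + L.C₀) ^ 2 = L.halfSum n ^ 2 := by
  rw [halfSum, mul_pow, ← C_pow]; norm_num

theorem C_half_mul_derivative (n : ℕ) :
    Polynomial.C (1 / 2) * derivative (L.Cn (n + 1) + L.C₀) = derivative (L.halfSum n) := by
  rw [halfSum, derivative_C_mul]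

theorem G13_eq (n : ℕ) : L.G13 n =
    L.Dn n * L.G02 n + L.halfSum n * L.G12 n + L.Φ * derivative (L.G12 n) := by
  simp only [G13, G02, G12, C_quarter_mul_sq, derivative_add (f := _ * _), derivative_mul]
  have hs := L.two_mul_halfSum n
  have h := L.C_half_mul_derivative n
  -- The closed form has `C_{n+1} + C_0` and its derivative where the recursion has `halfSum`.
  linear_combination L.B₀ * L.Φ * h - L.Φ * derivative L.B₀ * hs

theorem H3_eq (n : ℕ) : L.H3 n =
    -(L.D₀ * L.G02 n) - L.halfSum n * L.H2 n + L.Φ * derivative (L.H2 n) := by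
  rw [H3, C_quarter_mul_sq, C_half_mul_derivative, ← two_mul_halfSum]
  simp only [G02, H2, derivative_sub, derivative_mul, derivative_g]
  ring

theorem F2_eq_step (n : ℕ) (y : ℂ[X]) : L.F2 n y =
    L.Φ * derivative (L.F1 n y) + (L.D₀ * L.G11 n - L.Dn n * L.H1 n) * y := by
  simp only [F2, F1, M12, M02, G11, H1, derivative_add, derivative_mul,
    Function.iterate_succ_apply', Function.iterate_zero_apply]
  ring

theorem F3_eq_step (n : ℕ) (y : ℂ[X]) : L.F3 n y =
    L.Φ * derivative (L.F2 n y) + (L.D₀ * L.G12 n - L.Dn n * L.H2 n) * y := by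
  simp only [F3, F2, M23, M13, M03, derivative_add, derivative_mul, derivative_pow,
    Function.iterate_succ_apply', Function.iterate_zero_apply]
  push_cast
  simp only [map_ofNat]
  ring

theorem F4_eq_step (n : ℕ) (y : ℂ[X]) : L.F4 n y =
    L.Φ * derivative (L.F3 n y) + (L.D₀ * L.G13 n - L.Dn n * L.H3 n) * y := by
  simp only [F4, F3, M34, M24, M14, M04, derivative_add, derivative_mul, derivative_pow,
    Function.iterate_succ_apply', Function.iterate_zero_apply]
  push_cast
  simp only [map_ofNat]
  ring

namespace StructureRelations

variable {L} {n : ℕ} {y p w q : ℂ[X]}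

theorem F2_eq (h : L.StructureRelations n y p w q) :
    L.F2 n y = L.G02 n * q + L.G12 n * w + L.H2 n * p := by
  rw [F2_eq_step, h.F1_eq, h.mul_derivative_comb, ← G02_eq, ← G12_eq, ← H2_eq]
  ring

theorem F3_eq (h : L.StructureRelations n y p w q) :
    L.F3 n y = L.G03 n * q + L.G13 n * w + L.H3 n * p := by
  rw [F3_eq_step, h.F2_eq, h.mul_derivative_comb, ← G03_eq, ← G13_eq, ← H3_eq]
  ring

theorem F4_eq (h : L.StructureRelations n y p w q) :
    L.F4 n y = L.G04 n * q + L.G14 n * w + L.H4 n * p := by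
  rw [F4_eq_step, h.F3_eq, h.mul_derivative_comb, ← G04, ← G14, ← H4]
  ring

end StructureRelations

/-! ### Cofactor expansion and vanishing of the determinant -/

theorem coeff_comb_eq_minor_expansion (n : ℕ) (y : ℂ[X]) :
    L.coeffA n * derivative^[4] y + L.coeffB n * derivative^[3] y
      + L.coeffC n * derivative^[2] y + L.coeffD n * derivative y + L.coeffE n * y =
    L.F4 n y * L.Δ4 n - L.F3 n y * L.Δ3 n + L.F2 n y * L.Δ2 n - L.F1 n y * L.Δ1 n := by
  simp only [coeffA, coeffB, coeffC, coeffD, coeffE, F1, F2, F3, F4]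
  ring

theorem det_systemMatrix (n : ℕ) (y : ℂ[X]) :
    (L.systemMatrix n y).det =
      L.F4 n y * L.Δ4 n - L.F3 n y * L.Δ3 n + L.F2 n y * L.Δ2 n - L.F1 n y * L.Δ1 n := by
  simp only [systemMatrix, Δ1, Δ2, Δ3, Δ4]
  generalize L.F1 n y = f1, L.F2 n y = f2, L.F3 n y = f3, L.F4 n y = f4
  simp [Matrix.det_succ_row_zero, Fin.sum_univ_succ, Fin.succAbove]
  ring

/-- The `F` column is the combination of the other three with weights `q`, `w`, `p`, so the
expansion cancels identically. -/
theorem StructureRelations.minor_expansion_eq_zero {L : Data} {n : ℕ} {y p w q : ℂ[X]}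
    (h : L.StructureRelations n y p w q) :
    L.F4 n y * L.Δ4 n - L.F3 n y * L.Δ3 n + L.F2 n y * L.Δ2 n - L.F1 n y * L.Δ1 n = 0 := by
  rw [h.F1_eq, h.F2_eq, h.F3_eq, h.F4_eq, Δ1, Δ2, Δ3, Δ4]
  ring

end Data

end LaguerreHahn

theorem theorem3p4 (u : LaguerreHahn.Form) (hu : LaguerreHahn.moment u 0 = 1)
    (P : ℕ → Polynomial ℂ) (hP : LaguerreHahn.IsMOPS u P)
    (Φ B C D : Polynomial ℂ) (hR : LaguerreHahn.SatisfiesRiccati u Φ B C D) :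
    (∃ β γ : ℕ → ℂ, LaguerreHahn.IsRecurrence P β γ) ∧
    ∀ β γ : ℕ → ℂ, LaguerreHahn.IsRecurrence P β γ →
      ∀ (L : LaguerreHahn.Data), L = ⟨Φ, B, C, D, β, γ⟩ → ∀ n : ℕ,
        L.coeffA n * Polynomial.derivative^[4] (P (n + 1))
          + L.coeffB n * Polynomial.derivative^[3] (P (n + 1))
          + L.coeffC n * Polynomial.derivative^[2] (P (n + 1))
          + L.coeffD n * Polynomial.derivative (P (n + 1))
          + L.coeffE n * P (n + 1) = 0 ∧
        (L.systemMatrix n (P (n + 1))).det =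
          L.coeffA n * Polynomial.derivative^[4] (P (n + 1))
          + L.coeffB n * Polynomial.derivative^[3] (P (n + 1))
          + L.coeffC n * Polynomial.derivative^[2] (P (n + 1))
          + L.coeffD n * Polynomial.derivative (P (n + 1))
          + L.coeffE n * P (n + 1) := by
  refine ⟨hP.exists_isRecurrence, ?_⟩
  rintro β γ hrec L rfl n
  set L : LaguerreHahn.Data := ⟨Φ, B, C, D, β, γ⟩
  refine ⟨?_, ?_⟩
  · rw [L.coeff_comb_eq_minor_expansion]
    exact (L.structureRelations hrec n).minor_expansion_eq_zero
  · rw [L.coeff_comb_eq_minor_expansion, L.det_systemMatrix]
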